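/- Let $n\ge 3$ and $N=n-2$. Let $T,I\subseteq\mathbb R$ be open, let $a\in C^2(T)$ and $b,f_1,f_2\in C^2(I)$ be nowhere zero, and consider the spherical doubly warped metric $$ ds^2=g_{ij}dx^idx^j=-b^2(r)\,dt^2+a^2(t)\,g^\star_{\mu\nu}dx^\mu dx^\nu,\qquad g^\star_{\mu\nu}dx^\mu dx^\nu=f_1^2(r)\,dr^2+f_2^2(r)\,d\Omega^2_{n-2}, $$ for $t\in T$, $r\in I$, where $d\Omega^2_{n-2}$ is the metric of the unit sphere $S^{n-2}$ in any smooth local coordinates $\theta$ of the sphere (Latin indices run over the coordinates $(t,r,\theta)$ of spacetime, Greek ones over the space coordinates $(r,\theta)$). Let $u$ be the comoving unit time-like vector field, $u^0=1/b$, $u^\mu=0$, so that $g_{ij}u^iu^j=-1$. Let $\Gamma^k_{ij}$ be the Christoffel symbols of $g$, let $$R_{jkl}{}^m=-\partial_j\Gamma^m_{kl}+\partial_k\Gamma^m_{jl}+\Gamma^p_{jl}\Gamma^m_{kp}-\Gamma^p_{kl}\Gamma^m_{jp},\qquad R_{kl}=R_{kjl}{}^j,\qquad R=g^{kl}R_{kl},$$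 and let $E_{kl}=u^ju^mC_{jklm}$ be the electric tensor, where $$C_{jklm}=R_{jklm}+\frac{g_{jm}R_{kl}-g_{km}R_{jl}+R_{jm}g_{kl}-R_{km}g_{jl}}{n-2}-R\,\frac{g_{jm}g_{kl}-g_{km}g_{jl}}{(n-1)(n-2)}$$ is the Weyl tensor. Let $n_\mu$ be the covector with $n_r=f_1(r)$ and vanishing angular components, and let $N_i=(0,a\,n_\mu)$. Then $g^{\star\mu\nu}n_\mu n_\nu=1$, $g^{ij}N_iN_j=1$, the space components of the electric tensor are $$E_{\mu\nu}=E(r)\left[n_\mu n_\nu-\frac{g^\star_{\mu\nu}}{n-1}\right],$$ $$E(r)=\frac{n-3}{n-2}\,\frac1{f_1^2}\left[\frac{f_1^2}{f_2^2}+\frac{d^2}{dr^2}\log |f_2|-\frac{f_1'f_2'}{f_1f_2}+\frac{b'}{b}\frac{d}{dr}\log |f_1f_2|-\frac{b''}{b}\right],$$ where a prime is $d/dr$, and, for all spacetime indices $i,j$, $$E_{ij}=\frac{E(r)}{a^2(t)}\left[N_iN_j-\frac{h_{ij}}{n-1}\right],\qquad h_{ij}=g_{ij}+u_iu_j .$$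 -/

import Mathlib

open scoped ContDiff

noncomputable section

namespace DoublyWarped

/-! ### Curvature of a (pseudo-)Riemannian metric in a coordinate chart -/

section Curvature

variable {ι : Type*} [Fintype ι] [DecidableEq ι]

/-- The partial derivative of `F` with respect to the coordinate `i` at the point `x`. -/
def partialDeriv {κ : Type*} [DecidableEq κ] {E : Type*} [NormedAddCommGroup E] [NormedSpace ℝ E]
    (i : κ) (F : (κ → ℝ) → E) (x : κ → ℝ) : E :=
  deriv (fun s => F (Function.update x i s)) (x i)

/-- The Christoffel symbol `Γ^k_{ij}` of the metric with components `g x i j`. -/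
def christoffel (g : (ι → ℝ) → Matrix ι ι ℝ) (k i j : ι) (x : ι → ℝ) : ℝ :=
  (1 / 2) * ∑ l, (g x)⁻¹ k l *
    (partialDeriv i (fun y => g y j l) x + partialDeriv j (fun y => g y i l) x
      - partialDeriv l (fun y => g y i j) x)

/-- The Riemann tensor `R_{jkl}{}^m`, with the sign convention
`R_{jkl}{}^m = -∂_j Γ^m_{kl} + ∂_k Γ^m_{jl} + Γ^p_{jl} Γ^m_{kp} - Γ^p_{kl} Γ^m_{jp}`. -/
def riemannUp (g : (ι → ℝ) → Matrix ι ι ℝ) (j k l m : ι) (x : ι → ℝ) : ℝ :=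
  - partialDeriv j (christoffel g m k l) x + partialDeriv k (christoffel g m j l) x
    + ∑ p, (christoffel g p j l x * christoffel g m k p x
        - christoffel g p k l x * christoffel g m j p x)

/-- The Riemann tensor with all indices lowered, `R_{jklm} = R_{jkl}{}^p g_{pm}`. -/
def riemann (g : (ι → ℝ) → Matrix ι ι ℝ) (j k l m : ι) (x : ι → ℝ) : ℝ :=
  ∑ p, riemannUp g j k l p x * g x p m

/-- The Ricci tensor `R_{kl} = R_{kjl}{}^j`, that is
`∂_m Γ^m_{kl} - ∂_k Γ^m_{ml} + Γ^p_{kl} Γ^m_{mp} - Γ^p_{ml} Γ^m_{kp}`. -/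
def ricci (g : (ι → ℝ) → Matrix ι ι ℝ) (k l : ι) (x : ι → ℝ) : ℝ :=
  ∑ j, riemannUp g k j l j x

/-- The scalar curvature `R = g^{ij} R_{ij}`. -/
def scalarCurvature (g : (ι → ℝ) → Matrix ι ι ℝ) (x : ι → ℝ) : ℝ :=
  ∑ i, ∑ j, (g x)⁻¹ i j * ricci g i j x

/-- The Weyl tensor `C_{jklm}`, in the dimension `n = card ι`. -/
def weyl (g : (ι → ℝ) → Matrix ι ι ℝ) (j k l m : ι) (x : ι → ℝ) : ℝ :=
  riemann g j k l m x
    + (g x j m * ricci g k l x - g x k m * ricci g j l x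
        + ricci g j m x * g x k l - ricci g k m x * g x j l) / ((Fintype.card ι : ℝ) - 2)
    - scalarCurvature g x * (g x j m * g x k l - g x k m * g x j l)
        / (((Fintype.card ι : ℝ) - 1) * ((Fintype.card ι : ℝ) - 2))

/-- The electric tensor `E_{kl} = u^j u^m C_{jklm}` relative to the vector field `u^j`. -/
def electric (g : (ι → ℝ) → Matrix ι ι ℝ) (u : (ι → ℝ) → ι → ℝ) (k l : ι) (x : ι → ℝ) : ℝ :=
  ∑ j, ∑ m, u x j * u x m * weyl g j k l m x

/-- Lowering the index of a vector field, `v_i = g_{ij} v^j`. -/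
def lower (g : (ι → ℝ) → Matrix ι ι ℝ) (v : (ι → ℝ) → ι → ℝ) (x : ι → ℝ) (i : ι) : ℝ :=
  ∑ j, g x i j * v x j

end Curvature

/-! ### Doubly warped metrics

If `σ` indexes the space coordinates, then `Option σ` indexes the spacetime coordinates: `none` is
the time coordinate `t`, and `some μ` is the space coordinate `μ`. -/

/-- The point whose `none`-coordinate is `s` and whose other coordinates are those of `y`. -/
def extend {σ : Type*} (s : ℝ) (y : σ → ℝ) : Option σ → ℝ
  | none => s
  | some μ => y μ

/-- The doubly warped metric `-b(y)² dt² + a(t)² g⋆_{μν}(y) dy^μ dy^ν`. -/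
def dwMetric {σ : Type*} (b : (σ → ℝ) → ℝ) (a : ℝ → ℝ) (gs : (σ → ℝ) → Matrix σ σ ℝ)
    (x : Option σ → ℝ) : Matrix (Option σ) (Option σ) ℝ :=
  Matrix.of fun i j => match i, j with
    | none, none => -(b fun μ => x (some μ)) ^ 2
    | some μ, some ν => a (x none) ^ 2 * gs (fun ρ => x (some ρ)) μ ν
    | none, some _ => 0
    | some _, none => 0

/-- The comoving unit time-like vector field, `u^0 = 1 / b` and `u^μ = 0`. -/
def comoving {σ : Type*} (b : (σ → ℝ) → ℝ) (x : Option σ → ℝ) : Option σ → ℝ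
  | none => 1 / b fun μ => x (some μ)
  | some _ => 0

/-! ### Spherical space metrics

The unit sphere of dimension `N` is described by a local parametrization `ψ` defined on an open set
`U` of `ℝ^N` (the usual angles, stereographic coordinates, ...). The space coordinates are indexed
by `Option (Fin N)`: `none` is the radial coordinate `r`, and `some c` is the coordinate `θ_c` of
the sphere. -/

/-- `ψ` is a smooth local parametrization, on the open set `U`, of the unit sphere of `ℝ^(N+1)`:
it takes values in the sphere and its differential is injective at every point. -/
structure IsSphereParam {N : ℕ} (U : Set (Fin N → ℝ))
    (ψ : (Fin N → ℝ) → EuclideanSpace ℝ (Fin (N + 1))) : Prop where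
  isOpen : IsOpen U
  contDiffOn : ContDiffOn ℝ ∞ ψ U
  norm_eq_one : ∀ θ ∈ U, ‖ψ θ‖ = 1
  immersion : ∀ θ ∈ U, LinearIndependent ℝ fun c : Fin N => partialDeriv c ψ θ

/-- The round metric `dΩ_N²` of the unit sphere in the coordinates given by `ψ`. -/
def roundMetric {N : ℕ} (ψ : (Fin N → ℝ) → EuclideanSpace ℝ (Fin (N + 1))) (θ : Fin N → ℝ) :
    Matrix (Fin N) (Fin N) ℝ :=
  Matrix.of fun c d => inner ℝ (partialDeriv c ψ θ) (partialDeriv d ψ θ)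

/-- The space metric `g⋆ = f₁(r)² dr² + f₂(r)² dΩ_N²`. -/
def spaceMetric {N : ℕ} (f₁ f₂ : ℝ → ℝ) (ψ : (Fin N → ℝ) → EuclideanSpace ℝ (Fin (N + 1)))
    (y : Option (Fin N) → ℝ) : Matrix (Option (Fin N)) (Option (Fin N)) ℝ :=
  Matrix.of fun μ ν => match μ, ν with
    | none, none => f₁ (y none) ^ 2
    | some c, some d => f₂ (y none) ^ 2 * roundMetric ψ (fun e => y (some e)) c d
    | none, some _ => 0
    | some _, none => 0

/-- The unit radial covector of the space metric, `n_r = f₁(r)` and `n_c = 0`. -/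
def radialCovector {N : ℕ} (f₁ : ℝ → ℝ) (y : Option (Fin N) → ℝ) : Option (Fin N) → ℝ
  | none => f₁ (y none)
  | some _ => 0

/-- The spacetime covector `N_i = (0, a n_μ)`. -/
def radialCovectorST {N : ℕ} (a f₁ : ℝ → ℝ) (x : Option (Option (Fin N)) → ℝ) :
    Option (Option (Fin N)) → ℝ
  | none => 0
  | some μ => a (x none) * radialCovector f₁ (fun ν => x (some ν)) μ

/-- The spherical doubly warped metric `-b(r)² dt² + a(t)² (f₁(r)² dr² + f₂(r)² dΩ_N²)`. -/
def sphericalMetric {N : ℕ} (b a f₁ f₂ : ℝ → ℝ)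
    (ψ : (Fin N → ℝ) → EuclideanSpace ℝ (Fin (N + 1))) :
    (Option (Option (Fin N)) → ℝ) → Matrix (Option (Option (Fin N))) (Option (Option (Fin N))) ℝ :=
  dwMetric (fun y => b (y none)) a (spaceMetric f₁ f₂ ψ)

/-- The comoving unit vector field of the spherical doubly warped metric. -/
def sphericalVelocity {N : ℕ} (b : ℝ → ℝ) :
    (Option (Option (Fin N)) → ℝ) → Option (Option (Fin N)) → ℝ :=
  comoving fun y => b (y none)

/-- The scalar `E(r)`, in spacetime dimension `n`. -/
def electricScalar (n : ℕ) (b f₁ f₂ : ℝ → ℝ) (r : ℝ) : ℝ :=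
  ((n : ℝ) - 3) / ((n : ℝ) - 2) * (1 / f₁ r ^ 2) *
    (f₁ r ^ 2 / f₂ r ^ 2
      + deriv (deriv fun s => Real.log (f₂ s)) r
      - deriv f₁ r * deriv f₂ r / (f₁ r * f₂ r)
      + deriv b r / b r * deriv (fun s => Real.log (f₁ s * f₂ s)) r
      - deriv (deriv b) r / b r)

end DoublyWarped

end

open DoublyWarped

noncomputable section

namespace DoublyWarped

open Topology Filter

/-! Since `u` has only a time component, E_{kl} = b⁻² C_{tklt}. The metric is block diagonal in (t,
r, θ), so this component involves only R_{tkl}^t, R_tt, the space-space Ricci components and the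
scalar curvature. All of these are computed explicitly.

Each Christoffel symbol is a function of t times a function of r times one of four angular factors:
1, a Kronecker delta, the round metric γ, or a Christoffel symbol of γ
(`christoffel_sphericalMetric`). Differentiating it reduces to one-variable calculus, except where
the connection of γ itself is differentiated. Those terms assemble into the Ricci tensor of the
sphere, (N - 1)γ (`ricci_roundMetric`).

That identity is proved for an arbitrary chart ψ from the embedding. The Gauss formula expands
∂_c∂_dψ in the basis formed by the ∂_kψ and ψ; one more derivative and ∂_j∂_k = ∂_k∂_j give constant
curvature one (`riemannUp_roundMetric`).

In the Weyl combination all terms in a' and a'' cancel. The radial and angular blocks that remain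
are E f₁² N/(N+1) and -E f₂² γ/(N+1), which is the trace-free form asserted
(`IsSphericalData.electric_space`). The spacetime form follows because time components vanish on
both sides and N_μN_ν and h_{μν} both carry a factor a². -/

/-! ### Partial derivatives in the nested coordinates (t, (r, θ)) -/

theorem update_extend_none {σ : Type*} [DecidableEq σ] (t s : ℝ) (y : σ → ℝ) :
    Function.update (extend t y) none s = extend s y := by
  funext i
  cases i <;> simp [extend, Function.update]

theorem update_extend_some {σ : Type*} [DecidableEq σ] (t s : ℝ) (y : σ → ℝ) (i : σ) :
    Function.update (extend t y) (some i) s = extend t (Function.update y i s) := by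
  funext j
  cases j <;> simp [extend, Function.update]

theorem partialDeriv_none_extend {σ : Type*} [DecidableEq σ] {E : Type*} [NormedAddCommGroup E]
    [NormedSpace ℝ E] (F : (Option σ → ℝ) → E) (t : ℝ) (y : σ → ℝ) :
    partialDeriv none F (extend t y) = deriv (fun s => F (extend s y)) t := by
  simp only [partialDeriv, update_extend_none]
  rfl

theorem partialDeriv_some_extend {σ : Type*} [DecidableEq σ] {E : Type*} [NormedAddCommGroup E]
    [NormedSpace ℝ E] (F : (Option σ → ℝ) → E) (t : ℝ) (y : σ → ℝ) (i : σ) :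
    partialDeriv (some i) F (extend t y) = partialDeriv i (fun z => F (extend t z)) y := by
  simp only [partialDeriv, update_extend_some]
  rfl

theorem eventually_update_mem {κ : Type*} [DecidableEq κ] {U : Set (κ → ℝ)} (hU : IsOpen U)
    {θ : κ → ℝ} (hθ : θ ∈ U) (c : κ) : ∀ᶠ s in 𝓝 (θ c), Function.update θ c s ∈ U := by
  have h : Continuous fun s : ℝ => Function.update θ c s := by fun_prop
  apply h.continuousAt.eventually_mem
  simpa using hU.mem_nhds hθ

/-- A partial derivative sees only nearby values, so identities known merely on the open chart can
be differentiated. -/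
theorem partialDeriv_congr {κ : Type*} [DecidableEq κ] {E : Type*} [NormedAddCommGroup E]
    [NormedSpace ℝ E] {U : Set (κ → ℝ)} (hU : IsOpen U) {F G : (κ → ℝ) → E}
    (h : ∀ θ ∈ U, F θ = G θ) {θ : κ → ℝ} (hθ : θ ∈ U) (c : κ) :
    partialDeriv c F θ = partialDeriv c G θ := by
  apply EventuallyEq.deriv_eq
  filter_upwards [eventually_update_mem hU hθ c] with s hs using h _ hs

theorem partialDeriv_const {κ : Type*} [DecidableEq κ] {E : Type*} [NormedAddCommGroup E]
    [NormedSpace ℝ E] (v : E) (θ : κ → ℝ) (c : κ) :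
    partialDeriv c (fun _ => v) θ = 0 := by
  simp [partialDeriv]

theorem partialDeriv_const_mul {κ : Type*} [DecidableEq κ] (v : ℝ) (F : (κ → ℝ) → ℝ)
    (θ : κ → ℝ) (c : κ) :
    partialDeriv c (fun y => v * F y) θ = v * partialDeriv c F θ := by
  simp [partialDeriv]

/-! ### The block-diagonal metric and its inverse -/

section Metric

variable {N : ℕ} (b a f₁ f₂ : ℝ → ℝ) (ψ : (Fin N → ℝ) → EuclideanSpace ℝ (Fin (N + 1)))
  (t r : ℝ) (θ : Fin N → ℝ)

theorem sphericalMetric_tt :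
    sphericalMetric b a f₁ f₂ ψ (extend t (extend r θ)) none none = -b r ^ 2 := rfl

theorem sphericalMetric_rr :
    sphericalMetric b a f₁ f₂ ψ (extend t (extend r θ)) (some none) (some none)
      = a t ^ 2 * f₁ r ^ 2 := rfl

theorem sphericalMetric_ss (c d : Fin N) :
    sphericalMetric b a f₁ f₂ ψ (extend t (extend r θ)) (some (some c)) (some (some d))
      = a t ^ 2 * (f₂ r ^ 2 * roundMetric ψ θ c d) := rfl

theorem sphericalMetric_ts (μ : Option (Fin N)) :
    sphericalMetric b a f₁ f₂ ψ (extend t (extend r θ)) none (some μ) = 0 := rfl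

theorem sphericalMetric_st (μ : Option (Fin N)) :
    sphericalMetric b a f₁ f₂ ψ (extend t (extend r θ)) (some μ) none = 0 := rfl

theorem sphericalMetric_rs (c : Fin N) :
    sphericalMetric b a f₁ f₂ ψ (extend t (extend r θ)) (some none) (some (some c)) = 0 :=
  mul_zero _

theorem sphericalMetric_sr (c : Fin N) :
    sphericalMetric b a f₁ f₂ ψ (extend t (extend r θ)) (some (some c)) (some none) = 0 :=
  mul_zero _

/-- The block-diagonal inverse of the spherical doubly warped metric. -/
def sphericalInverse (b a f₁ f₂ : ℝ → ℝ) (ψ : (Fin N → ℝ) → EuclideanSpace ℝ (Fin (N + 1)))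
    (t r : ℝ) (θ : Fin N → ℝ) : Matrix (Option (Option (Fin N))) (Option (Option (Fin N))) ℝ :=
  Matrix.of fun i j => match i, j with
    | none, none => -1 / b r ^ 2
    | some none, some none => 1 / (a t ^ 2 * f₁ r ^ 2)
    | some (some c), some (some d) => 1 / (a t ^ 2 * f₂ r ^ 2) * (roundMetric ψ θ)⁻¹ c d
    | _, _ => 0

theorem inv_sphericalMetric (hb : b r ≠ 0) (ha : a t ≠ 0) (hf₁ : f₁ r ≠ 0) (hf₂ : f₂ r ≠ 0)
    (hγ : IsUnit (roundMetric ψ θ).det) :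
    (sphericalMetric b a f₁ f₂ ψ (extend t (extend r θ)))⁻¹
      = sphericalInverse b a f₁ f₂ ψ t r θ := by
  apply Matrix.inv_eq_right_inv
  have h := Matrix.mul_nonsing_inv _ hγ
  have h' : ∀ c d, ∑ e, roundMetric ψ θ c e * (roundMetric ψ θ)⁻¹ e d
      = (1 : Matrix (Fin N) (Fin N) ℝ) c d := fun c d => by rw [← h, Matrix.mul_apply]
  ext i j
  rw [Matrix.mul_apply]
  rcases i with _ | _ | c <;> rcases j with _ | _ | d <;>
    simp [Fintype.sum_option, sphericalInverse, sphericalMetric_tt, sphericalMetric_rr,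
      sphericalMetric_ss, sphericalMetric_ts, sphericalMetric_st, sphericalMetric_rs,
      sphericalMetric_sr, Matrix.one_apply]
  · field_simp
  · field_simp
  · have : ∀ e, a t ^ 2 * (f₂ r ^ 2 * roundMetric ψ θ c e)
        * ((f₂ r ^ 2)⁻¹ * (a t ^ 2)⁻¹ * (roundMetric ψ θ)⁻¹ e d)
        = roundMetric ψ θ c e * (roundMetric ψ θ)⁻¹ e d := fun e => by field_simp
    simp only [this, h', Matrix.one_apply]

/-- The inverse of the space metric acts trivially on the radial direction. -/
theorem inv_spaceMetric_rr (hf₁ : f₁ r ≠ 0) (hf₂ : f₂ r ≠ 0)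
    (hγ : IsUnit (roundMetric ψ θ).det) :
    (spaceMetric f₁ f₂ ψ (extend r θ))⁻¹ none none = 1 / f₁ r ^ 2 := by
  have key : (spaceMetric f₁ f₂ ψ (extend r θ))⁻¹ = Matrix.of fun i j => match i, j with
      | none, none => 1 / f₁ r ^ 2
      | some c, some d => 1 / f₂ r ^ 2 * (roundMetric ψ θ)⁻¹ c d
      | _, _ => 0 := by
    apply Matrix.inv_eq_right_inv
    have h := Matrix.mul_nonsing_inv _ hγ
    have h' : ∀ c d, ∑ e, roundMetric ψ θ c e * (roundMetric ψ θ)⁻¹ e d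
        = (1 : Matrix (Fin N) (Fin N) ℝ) c d := fun c d => by rw [← h, Matrix.mul_apply]
    ext i j
    rw [Matrix.mul_apply]
    rcases i with _ | c <;> rcases j with _ | d <;>
      simp [Fintype.sum_option, spaceMetric, extend, Matrix.one_apply, hf₁]
    have : ∀ e, (f₂ r ^ 2 * roundMetric ψ θ c e)
        * ((f₂ r ^ 2)⁻¹ * (roundMetric ψ θ)⁻¹ e d)
        = roundMetric ψ θ c e * (roundMetric ψ θ)⁻¹ e d := fun e => by field_simp
    simp only [this, h', Matrix.one_apply]
  rw [key]
  rfl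

end Metric

/-! ### The connection of the warped metric -/

/-- The Christoffel symbols of the spherical doubly warped metric. -/
def sphericalChristoffel {N : ℕ} (b a f₁ f₂ : ℝ → ℝ)
    (ψ : (Fin N → ℝ) → EuclideanSpace ℝ (Fin (N + 1))) (k i j : Option (Option (Fin N)))
    (t r : ℝ) (θ : Fin N → ℝ) : ℝ :=
  match k, i, j with
  | none, none, some none => deriv b r / b r
  | none, some none, none => deriv b r / b r
  | none, some none, some none => a t * deriv a t * (f₁ r ^ 2 / b r ^ 2)
  | none, some (some c), some (some d) =>
      a t * deriv a t * (f₂ r ^ 2 / b r ^ 2 * roundMetric ψ θ c d)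
  | some none, none, none => 1 / a t ^ 2 * (b r * deriv b r / f₁ r ^ 2)
  | some none, none, some none => deriv a t / a t
  | some none, some none, none => deriv a t / a t
  | some none, some none, some none => deriv f₁ r / f₁ r
  | some none, some (some c), some (some d) =>
      -(f₂ r * deriv f₂ r / f₁ r ^ 2) * roundMetric ψ θ c d
  | some (some c), none, some (some d) => if c = d then deriv a t / a t else 0
  | some (some c), some (some d), none => if c = d then deriv a t / a t else 0
  | some (some c), some none, some (some d) => if c = d then deriv f₂ r / f₂ r else 0
  | some (some c), some (some d), some none => if c = d then deriv f₂ r / f₂ r else 0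
  | some (some c), some (some d), some (some e) => christoffel (roundMetric ψ) c d e θ
  | _, _, _ => 0

theorem deriv_sq {f : ℝ → ℝ} {x : ℝ} (hf : DifferentiableAt ℝ f x) :
    deriv (fun s => f s ^ 2) x = 2 * f x * deriv f x := by
  rw [deriv_fun_pow hf]; simp

theorem roundMetric_symm {N : ℕ} (ψ : (Fin N → ℝ) → EuclideanSpace ℝ (Fin (N + 1)))
    (θ : Fin N → ℝ) (c d : Fin N) : roundMetric ψ θ c d = roundMetric ψ θ d c :=
  real_inner_comm (partialDeriv d ψ θ) (partialDeriv c ψ θ)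

/-- Every metric component is a product of functions of t, r and θ separately, so each partial
derivative falls on a single factor, and the inverse metric does not mix the three blocks. -/
theorem christoffel_sphericalMetric {N : ℕ} {b a f₁ f₂ : ℝ → ℝ}
    {ψ : (Fin N → ℝ) → EuclideanSpace ℝ (Fin (N + 1))} {t r : ℝ} {θ : Fin N → ℝ}
    (hb : DifferentiableAt ℝ b r) (ha : DifferentiableAt ℝ a t)
    (hf₁ : DifferentiableAt ℝ f₁ r) (hf₂ : DifferentiableAt ℝ f₂ r)
    (hb0 : b r ≠ 0) (ha0 : a t ≠ 0) (hf₁0 : f₁ r ≠ 0) (hf₂0 : f₂ r ≠ 0)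
    (hγ : IsUnit (roundMetric ψ θ).det) (k i j : Option (Option (Fin N))) :
    christoffel (sphericalMetric b a f₁ f₂ ψ) k i j (extend t (extend r θ))
      = sphericalChristoffel b a f₁ f₂ ψ k i j t r θ := by
  have h := Matrix.nonsing_inv_mul _ hγ
  have h'' : ∀ c d, ∑ e, (roundMetric ψ θ)⁻¹ c e * roundMetric ψ θ d e
      = if c = d then (1 : ℝ) else 0 := fun c d => by
    simp_rw [roundMetric_symm ψ θ d]
    rw [← Matrix.one_apply, ← h, Matrix.mul_apply]
  -- Sums over the sphere block in the mixed symbols are multiples of γ^{ce}γ_{de}, hence Kronecker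
  -- deltas.
  have hs : ∀ (x : ℝ) (c d : Fin N) (F : Fin N → ℝ),
      (∀ e, F e = x * ((roundMetric ψ θ)⁻¹ c e * roundMetric ψ θ d e)) →
        ∑ e, F e = if c = d then x else 0 := fun x c d F hF => by
    rw [Finset.sum_congr rfl fun e _ => hF e, ← Finset.mul_sum, h'', mul_ite, mul_one, mul_zero]
  rw [christoffel, inv_sphericalMetric b a f₁ f₂ ψ t r θ hb0 ha0 hf₁0 hf₂0 hγ]
  rcases k with _ | _ | c <;> rcases i with _ | _ | d <;> rcases j with _ | _ | e <;>
    simp only [Fintype.sum_option, sphericalInverse, Matrix.of_apply, zero_mul, add_zero, zero_add,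
      partialDeriv_none_extend, partialDeriv_some_extend, Finset.sum_const_zero,
      sphericalMetric_tt, sphericalMetric_rr,
      sphericalMetric_ss, sphericalMetric_ts, sphericalMetric_st, sphericalMetric_rs,
      sphericalMetric_sr, deriv_const, partialDeriv_const, partialDeriv_const_mul,
      deriv_const_mul_field, deriv_mul_const_field, deriv.fun_neg, deriv_sq, hb, ha, hf₁, hf₂,
      sphericalChristoffel, sub_zero, zero_sub, mul_zero, neg_zero]
  case none.none.some.none | none.some.none.none | none.some.none.some.none
      | none.some.some.some.some | some.none.none.none | some.none.none.some.none
      | some.none.some.none.none | some.none.some.some.some.some => field_simp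
  case some.none.some.none.some.none =>
    field_simp
    ring
  case some.some.none.some.some =>
    -- The 2 comes from differentiating a²; it cancels the 1/2 in the Christoffel symbol.
    rw [hs (2 * deriv a t / a t) c e _ fun l => by field_simp]
    split_ifs <;> ring
  case some.some.some.none.some.some =>
    rw [hs (2 * deriv f₂ r / f₂ r) c e _ fun l => by field_simp]
    split_ifs <;> ring
  case some.some.some.some.none =>
    rw [hs (2 * deriv a t / a t) c d _ fun l => by field_simp]
    split_ifs <;> ring
  case some.some.some.some.some.none =>
    rw [hs (2 * deriv f₂ r / f₂ r) c d _ fun l => by field_simp]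
    split_ifs <;> ring
  -- With all indices on the sphere, the factor a²f₂² cancels against its inverse and the connection
  -- of γ remains.
  case some.some.some.some.some.some =>
    rw [christoffel]
    congr 1
    refine Finset.sum_congr rfl fun l _ => ?_
    field_simp

/-! ### Smooth functions of several variables: mixed partials and matrix inverses -/

section PartialDeriv

variable {κ : Type*} [Fintype κ] [DecidableEq κ] {E : Type*} [NormedAddCommGroup E]
  [NormedSpace ℝ E] {F : (κ → ℝ) → E} {θ : κ → ℝ} {U : Set (κ → ℝ)}

theorem hasDerivAt_partialDeriv (hF : DifferentiableAt ℝ F θ) (c : κ) :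
    HasDerivAt (fun s => F (Function.update θ c s)) (partialDeriv c F θ) (θ c) := by
  apply DifferentiableAt.hasDerivAt
  have h : DifferentiableAt ℝ F (Function.update θ c (θ c)) := by simpa using hF
  exact h.comp (θ c) (hasDerivAt_update θ c (θ c)).differentiableAt

theorem partialDeriv_eq_fderiv (hF : DifferentiableAt ℝ F θ) (c : κ) :
    partialDeriv c F θ = fderiv ℝ F θ (Pi.single c 1) := by
  have h : HasFDerivAt F (fderiv ℝ F θ) (Function.update θ c (θ c)) := by
    simpa using hF.hasFDerivAt
  exact (h.comp_hasDerivAt (θ c) (hasDerivAt_update θ c (θ c))).deriv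

omit [DecidableEq κ] in
theorem differentiableAt_of_contDiffOn (hU : IsOpen U) (hF : ContDiffOn ℝ ∞ F U) (hθ : θ ∈ U) :
    DifferentiableAt ℝ F θ :=
  (hF.contDiffAt (hU.mem_nhds hθ)).differentiableAt (by simp)

theorem contDiffOn_partialDeriv (hU : IsOpen U) (hF : ContDiffOn ℝ ∞ F U) (c : κ) :
    ContDiffOn ℝ ∞ (partialDeriv c F) U := by
  have h : ContDiffOn ℝ ∞ (fun y => fderiv ℝ F y (Pi.single c 1)) U :=
    (hF.fderiv_of_isOpen hU (by simp)).clm_apply contDiffOn_const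
  exact h.congr fun y hy => partialDeriv_eq_fderiv (differentiableAt_of_contDiffOn hU hF hy) c

theorem partialDeriv_comm (hU : IsOpen U) (hF : ContDiffOn ℝ ∞ F U) (hθ : θ ∈ U) (c d : κ) :
    partialDeriv c (partialDeriv d F) θ = partialDeriv d (partialDeriv c F) θ := by
  have key : ∀ c d : κ, partialDeriv c (partialDeriv d F) θ
      = fderiv ℝ (fderiv ℝ F) θ (Pi.single c 1) (Pi.single d 1) := fun c d => by
    rw [partialDeriv_congr hU (G := fun y => fderiv ℝ F y (Pi.single d 1))
      (fun y hy => partialDeriv_eq_fderiv (differentiableAt_of_contDiffOn hU hF hy) d) hθ]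
    have h : DifferentiableAt ℝ (fderiv ℝ F) θ :=
      differentiableAt_of_contDiffOn hU (hF.fderiv_of_isOpen hU (by simp)) hθ
    rw [partialDeriv_eq_fderiv (h.clm_apply (differentiableAt_const _)),
      fderiv_clm_apply h (differentiableAt_const _)]
    simp
  rw [key, key]
  exact ((hF.contDiffAt (hU.mem_nhds hθ)).isSymmSndFDerivAt
    (by rw [minSmoothness_of_isRCLikeNormedField]; exact WithTop.coe_le_coe.2 le_top)) _ _

omit [DecidableEq κ] in
theorem contDiffOn_det {ι : Type*} [Fintype ι] [DecidableEq ι] {A : (κ → ℝ) → Matrix ι ι ℝ}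
    (hA : ∀ i j, ContDiffOn ℝ ∞ (fun y => A y i j) U) :
    ContDiffOn ℝ ∞ (fun y => (A y).det) U := by
  simp only [Matrix.det_apply]
  refine ContDiffOn.sum fun τ _ => ContDiffOn.const_smul _ ?_
  exact contDiffOn_prod fun i _ => hA _ _

omit [DecidableEq κ] in
-- By Cramer's rule an entry of the inverse is a quotient of two determinants, the lower one
-- nonvanishing.
theorem contDiffOn_inv_apply {ι : Type*} [Fintype ι] [DecidableEq ι]
    {A : (κ → ℝ) → Matrix ι ι ℝ} (hA : ∀ i j, ContDiffOn ℝ ∞ (fun y => A y i j) U)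
    (h : ∀ y ∈ U, IsUnit (A y).det) (i j : ι) : ContDiffOn ℝ ∞ (fun y => (A y)⁻¹ i j) U := by
  simp only [Matrix.inv_def, Ring.inverse_eq_inv', Matrix.smul_apply, smul_eq_mul,
    Matrix.adjugate_apply]
  refine ((contDiffOn_det hA).inv fun y hy => (h y hy).ne_zero).mul (contDiffOn_det fun k l => ?_)
  -- The adjugate entry is the determinant after row j is replaced by a constant basis vector.
  by_cases hk : k = j
  · subst hk
    simpa using contDiffOn_const
  · simpa [Matrix.updateRow_ne hk] using hA k l

end PartialDeriv

/-! ### The unit sphere: Gauss formula and constant curvature -/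

section Sphere

variable {N : ℕ} {U : Set (Fin N → ℝ)} {ψ : (Fin N → ℝ) → EuclideanSpace ℝ (Fin (N + 1))}
  (hψ : IsSphereParam U ψ) {θ : Fin N → ℝ} (hθ : θ ∈ U)

include hψ

theorem contDiffOn_roundMetric (c d : Fin N) :
    ContDiffOn ℝ ∞ (fun y => roundMetric ψ y c d) U :=
  (contDiffOn_partialDeriv hψ.isOpen hψ.contDiffOn c).inner ℝ
    (contDiffOn_partialDeriv hψ.isOpen hψ.contDiffOn d)

include hθ in
-- The round metric is the Gram matrix of the independent vectors ∂_cψ, hence positive definite.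
theorem isUnit_det_roundMetric : IsUnit (roundMetric ψ θ).det :=
  (Matrix.posDef_gram_of_linearIndependent (𝕜 := ℝ) (hψ.immersion θ hθ)).isUnit.map
    Matrix.detMonoidHom

theorem contDiffOn_christoffel_roundMetric (k c d : Fin N) :
    ContDiffOn ℝ ∞ (christoffel (roundMetric ψ) k c d) U := by
  unfold christoffel
  have h : ∀ i j l, ContDiffOn ℝ ∞ (partialDeriv i fun y => roundMetric ψ y j l) U :=
    fun i j l => contDiffOn_partialDeriv hψ.isOpen (contDiffOn_roundMetric hψ j l) i
  refine contDiffOn_const.mul (ContDiffOn.sum fun l _ => ?_)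
  exact (contDiffOn_inv_apply (contDiffOn_roundMetric hψ)
    (fun y hy => isUnit_det_roundMetric hψ hy) k l).mul (((h _ _ _).add (h _ _ _)).sub (h _ _ _))

include hθ

/-- Differentiate ⟨ψ, ψ⟩ = 1. -/
theorem inner_partialDeriv_self (c : Fin N) : inner ℝ (partialDeriv c ψ θ) (ψ θ) = 0 := by
  have h := hasDerivAt_partialDeriv
    (differentiableAt_of_contDiffOn hψ.isOpen hψ.contDiffOn hθ) c
  have h2 := h.inner ℝ h
  have h3 : (fun s => inner ℝ (ψ (Function.update θ c s)) (ψ (Function.update θ c s)))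
      =ᶠ[𝓝 (θ c)] fun _ => (1 : ℝ) := by
    filter_upwards [eventually_update_mem hψ.isOpen hθ c] with s hs
    simp [hψ.norm_eq_one _ hs]
  have h4 := (h2.congr_of_eventuallyEq h3.symm).unique (hasDerivAt_const (θ c) (1 : ℝ))
  simp only [Function.update_eq_self] at h4
  rw [real_inner_comm] at h4
  linarith

theorem partialDeriv_inner {E : Type*} [NormedAddCommGroup E] [InnerProductSpace ℝ E]
    {F G : (Fin N → ℝ) → E} (hF : ContDiffOn ℝ ∞ F U) (hG : ContDiffOn ℝ ∞ G U) (c : Fin N) :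
    partialDeriv c (fun y => inner ℝ (F y) (G y)) θ
      = inner ℝ (F θ) (partialDeriv c G θ) + inner ℝ (partialDeriv c F θ) (G θ) := by
  have h1 := hasDerivAt_partialDeriv (differentiableAt_of_contDiffOn hψ.isOpen hF hθ) c
  have h2 := hasDerivAt_partialDeriv (differentiableAt_of_contDiffOn hψ.isOpen hG hθ) c
  have h := (h1.inner ℝ h2).deriv
  simp only [Function.update_eq_self] at h
  exact h

theorem partialDeriv_roundMetric (c d e : Fin N) :
    partialDeriv c (fun y => roundMetric ψ y d e) θ
      = inner ℝ (partialDeriv d ψ θ) (partialDeriv c (partialDeriv e ψ) θ)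
        + inner ℝ (partialDeriv c (partialDeriv d ψ) θ) (partialDeriv e ψ θ) :=
  partialDeriv_inner hψ hθ (contDiffOn_partialDeriv hψ.isOpen hψ.contDiffOn d)
    (contDiffOn_partialDeriv hψ.isOpen hψ.contDiffOn e) c

/-- The normal part of the second derivatives of the parametrization. -/
theorem inner_second_partialDeriv_self (c d : Fin N) :
    inner ℝ (partialDeriv c (partialDeriv d ψ) θ) (ψ θ) = -roundMetric ψ θ c d := by
  -- Differentiate ⟨∂_dψ, ψ⟩ = 0 along c.
  have h := partialDeriv_congr hψ.isOpen (fun y hy => inner_partialDeriv_self hψ hy d) hθ c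
  rw [partialDeriv_const, partialDeriv_inner hψ hθ
    (contDiffOn_partialDeriv hψ.isOpen hψ.contDiffOn d) hψ.contDiffOn] at h
  have h' : inner ℝ (partialDeriv d ψ θ) (partialDeriv c ψ θ) = roundMetric ψ θ c d :=
    real_inner_comm _ _
  linarith

/-- The tangential part of the second derivatives of the parametrization. -/
theorem inner_second_partialDeriv (c d e : Fin N) :
    inner ℝ (partialDeriv c (partialDeriv d ψ) θ) (partialDeriv e ψ θ)
      = ∑ k, christoffel (roundMetric ψ) k c d θ * roundMetric ψ θ k e := by
  have h' : ∀ l, ∑ k, (roundMetric ψ θ)⁻¹ k l * roundMetric ψ θ k e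
      = if l = e then (1 : ℝ) else 0 := fun l => by
    rw [if_congr eq_comm rfl rfl, ← Matrix.one_apply,
      ← Matrix.mul_nonsing_inv _ (isUnit_det_roundMetric hψ hθ), Matrix.mul_apply]
    exact Finset.sum_congr rfl fun k _ => by rw [roundMetric_symm ψ θ k e, mul_comm]
  simp only [christoffel, Finset.mul_sum, Finset.sum_mul]
  rw [Finset.sum_comm]
  have h2 : ∀ l, ∑ k, 1 / 2 * ((roundMetric ψ θ)⁻¹ k l *
      (partialDeriv c (fun y => roundMetric ψ y d l) θ
        + partialDeriv d (fun y => roundMetric ψ y c l) θ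
        - partialDeriv l (fun y => roundMetric ψ y c d) θ)) * roundMetric ψ θ k e
      = if l = e then inner ℝ (partialDeriv c (partialDeriv d ψ) θ) (partialDeriv l ψ θ)
        else 0 := fun l => by
    set I : ℝ := inner ℝ (partialDeriv c (partialDeriv d ψ) θ) (partialDeriv l ψ θ) with hI
    rw [← mul_one I, ← mul_zero I, ← mul_ite, ← h' l, Finset.mul_sum]
    refine Finset.sum_congr rfl fun k _ => ?_
    -- Koszul's computation: once mixed partials are commuted, the bracket in the Christoffel symbol
    -- is 2⟨∂_c∂_dψ, ∂_lψ⟩.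
    rw [partialDeriv_roundMetric hψ hθ, partialDeriv_roundMetric hψ hθ,
      partialDeriv_roundMetric hψ hθ, partialDeriv_comm hψ.isOpen hψ.contDiffOn hθ l c,
      partialDeriv_comm hψ.isOpen hψ.contDiffOn hθ l d,
      partialDeriv_comm hψ.isOpen hψ.contDiffOn hθ d c,
      hI, real_inner_comm (partialDeriv d ψ θ) (partialDeriv c (partialDeriv l ψ) θ)]
    ring
  simp only [h2, Finset.sum_ite_eq', Finset.mem_univ, if_true]

omit hθ in
-- The unit vector ψ is orthogonal to the N independent tangent vectors, so together they form a
-- basis of ℝ^(N+1), and a vector orthogonal to a basis vanishes.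
theorem eq_zero_of_inner_eq_zero (hθ : θ ∈ U) {v : EuclideanSpace ℝ (Fin (N + 1))}
    (h0 : inner ℝ v (ψ θ) = 0) (h : ∀ e, inner ℝ v (partialDeriv e ψ θ) = 0) : v = 0 := by
  have hli : LinearIndependent ℝ
      fun o : Option (Fin N) => o.elim (ψ θ) fun c => partialDeriv c ψ θ := by
    refine linearIndependent_option.2 ⟨hψ.immersion θ hθ, fun hmem => ?_⟩
    have : ∀ w ∈ Submodule.span ℝ (Set.range fun c => partialDeriv c ψ θ),
        inner ℝ w (ψ θ) = 0 := fun w hw => by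
      induction hw using Submodule.span_induction with
      | mem x hx => obtain ⟨c, rfl⟩ := hx; exact inner_partialDeriv_self hψ hθ c
      | zero => simp
      | add x y _ _ hx hy => rw [inner_add_left, hx, hy, add_zero]
      | smul s x _ hx => rw [real_inner_smul_left, hx, mul_zero]
    have h1 := this _ hmem
    simp [hψ.norm_eq_one _ hθ] at h1
  have hspan := hli.span_eq_top_of_card_eq_finrank' (by simp)
  have hv : v ∈ Submodule.span ℝ
      (Set.range fun o : Option (Fin N) => o.elim (ψ θ) fun c => partialDeriv c ψ θ) := by
    rw [hspan]; trivial
  have : ∀ w ∈ Submodule.span ℝ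
      (Set.range fun o : Option (Fin N) => o.elim (ψ θ) fun c => partialDeriv c ψ θ),
      inner ℝ v w = 0 := fun w hw => by
    induction hw using Submodule.span_induction with
    | mem x hx => obtain ⟨_ | c, rfl⟩ := hx; exacts [h0, h c]
    | zero => simp
    | add x y _ _ hx hy => rw [inner_add_right, hx, hy, add_zero]
    | smul s x _ hx => rw [real_inner_smul_right, hx, mul_zero]
  exact inner_self_eq_zero.1 (this v hv)

/-- The Gauss formula for the unit sphere. -/
theorem second_partialDeriv_eq (c d : Fin N) :
    partialDeriv c (partialDeriv d ψ) θ
      = ∑ k, christoffel (roundMetric ψ) k c d θ • partialDeriv k ψ θ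
        - roundMetric ψ θ c d • ψ θ := by
  rw [← sub_eq_zero]
  refine eq_zero_of_inner_eq_zero hψ hθ ?_ fun e => ?_
  · simp [inner_sub_left, sum_inner, real_inner_smul_left, inner_partialDeriv_self hψ hθ,
      inner_second_partialDeriv_self hψ hθ, hψ.norm_eq_one _ hθ]
  · simp only [inner_sub_left, sum_inner, real_inner_smul_left,
      inner_second_partialDeriv hψ hθ, real_inner_comm (partialDeriv e ψ θ) (ψ θ),
      inner_partialDeriv_self hψ hθ]
    simp [roundMetric]

/-- Differentiate the Gauss formula and substitute it again for the new second derivatives. The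
derivative of the normal term γ_{cd}ψ contributes -γ_{cd}∂_jψ, which is the source of the curvature.
-/
theorem third_partialDeriv_eq (j c d : Fin N) :
    partialDeriv j (partialDeriv c (partialDeriv d ψ)) θ
      = ∑ m, (partialDeriv j (christoffel (roundMetric ψ) m c d) θ
          + ∑ k, christoffel (roundMetric ψ) k c d θ * christoffel (roundMetric ψ) m j k θ
          - if m = j then roundMetric ψ θ c d else 0) • partialDeriv m ψ θ
        - (partialDeriv j (fun y => roundMetric ψ y c d) θ
          + ∑ k, christoffel (roundMetric ψ) k c d θ * roundMetric ψ θ j k) • ψ θ := by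
  rw [partialDeriv_congr hψ.isOpen (fun y hy => second_partialDeriv_eq hψ hy c d) hθ]
  have hd : ∀ {E : Type} [NormedAddCommGroup E] [NormedSpace ℝ E] {F : (Fin N → ℝ) → E},
      ContDiffOn ℝ ∞ F U → HasDerivAt (fun s => F (Function.update θ j s)) (partialDeriv j F θ)
        (θ j) :=
    fun hF => hasDerivAt_partialDeriv (differentiableAt_of_contDiffOn hψ.isOpen hF hθ) j
  have h1 := ((HasDerivAt.fun_sum (u := Finset.univ) fun k _ =>
    (hd (contDiffOn_christoffel_roundMetric hψ k c d)).smul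
      (hd (contDiffOn_partialDeriv hψ.isOpen hψ.contDiffOn k))).sub
    ((hd (contDiffOn_roundMetric hψ c d)).smul (hd hψ.contDiffOn))).deriv
  refine Eq.trans h1 ?_
  simp only [Function.update_eq_self, second_partialDeriv_eq hψ hθ j, smul_sub, Finset.smul_sum,
    Finset.sum_add_distrib, Finset.sum_sub_distrib, add_smul, sub_smul, Finset.sum_smul, smul_smul,
    ite_smul, zero_smul, Finset.sum_ite_eq', Finset.mem_univ, if_true]
  rw [Finset.sum_comm]
  abel

/-- The unit sphere has constant curvature one. -/
theorem riemannUp_roundMetric (j k l m : Fin N) :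
    riemannUp (roundMetric ψ) j k l m θ
      = (if m = k then roundMetric ψ θ j l else 0) - if m = j then roundMetric ψ θ k l else 0 := by
  have h := partialDeriv_comm hψ.isOpen
    (contDiffOn_partialDeriv hψ.isOpen hψ.contDiffOn l) hθ j k
  rw [third_partialDeriv_eq hψ hθ, third_partialDeriv_eq hψ hθ, sub_eq_sub_iff_sub_eq_sub,
    ← Finset.sum_sub_distrib, ← sub_smul] at h
  simp only [← sub_smul] at h
  set X : Fin N → ℝ := fun m => (partialDeriv j (christoffel (roundMetric ψ) m k l) θ
          + ∑ p, christoffel (roundMetric ψ) p k l θ * christoffel (roundMetric ψ) m j p θ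
          - if m = j then roundMetric ψ θ k l else 0)
      - (partialDeriv k (christoffel (roundMetric ψ) m j l) θ
          + ∑ p, christoffel (roundMetric ψ) p j l θ * christoffel (roundMetric ψ) m k p θ
          - if m = k then roundMetric ψ θ j l else 0) with hX
  -- By `h` this tangent vector is a multiple of the normal ψ, so it is orthogonal to itself; the
  -- normal coefficients need not be compared.
  have hw : ∑ m, X m • partialDeriv m ψ θ = 0 := by
    have h0 : inner ℝ (∑ m, X m • partialDeriv m ψ θ) (ψ θ) = 0 := by
      simp [sum_inner, real_inner_smul_left, inner_partialDeriv_self hψ hθ]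
    rw [← inner_self_eq_zero (𝕜 := ℝ)]
    nth_rewrite 2 [h]
    rw [real_inner_smul_right, h0, mul_zero]
  have hm := Fintype.linearIndependent_iff.1 (hψ.immersion θ hθ) X hw m
  simp only [hX] at hm
  simp only [riemannUp, Finset.sum_sub_distrib]
  linarith

theorem ricci_roundMetric (k l : Fin N) :
    ricci (roundMetric ψ) k l θ = ((N : ℝ) - 1) * roundMetric ψ θ k l := by
  simp only [ricci, riemannUp_roundMetric hψ hθ, Finset.sum_sub_distrib, if_true]
  simp [sub_mul]

end Sphere

/-! ### One-variable derivatives of the warping functions -/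

theorem differentiableAt_of_contDiffOn_two {f : ℝ → ℝ} {s : Set ℝ} (hs : IsOpen s)
    (hf : ContDiffOn ℝ 2 f s) {x : ℝ} (hx : x ∈ s) : DifferentiableAt ℝ f x :=
  (hf.contDiffAt (hs.mem_nhds hx)).differentiableAt (by simp)

theorem differentiableAt_deriv_of_contDiffOn_two {f : ℝ → ℝ} {s : Set ℝ} (hs : IsOpen s)
    (hf : ContDiffOn ℝ 2 f s) {x : ℝ} (hx : x ∈ s) : DifferentiableAt ℝ (deriv f) x :=
  ((hf.deriv_of_isOpen (m := 1) hs (by norm_num)).contDiffAt (hs.mem_nhds hx)).differentiableAt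
    (by simp)

theorem christoffel_roundMetric_symm {N : ℕ}
    (ψ : (Fin N → ℝ) → EuclideanSpace ℝ (Fin (N + 1))) (k c d : Fin N) (θ : Fin N → ℝ) :
    christoffel (roundMetric ψ) k c d θ = christoffel (roundMetric ψ) k d c θ := by
  simp only [christoffel, roundMetric_symm ψ _ d c]
  congr 1
  exact Finset.sum_congr rfl fun l _ => by ring

section Derivatives

variable {f g : ℝ → ℝ} {x : ℝ}

theorem deriv_mul_deriv_self (hf : DifferentiableAt ℝ f x) (hf' : DifferentiableAt ℝ (deriv f) x) :
    deriv (fun s => f s * deriv f s) x = deriv f x ^ 2 + f x * deriv (deriv f) x := by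
  rw [deriv_fun_mul hf hf']
  ring

theorem deriv_logDeriv (hf : DifferentiableAt ℝ f x) (hf' : DifferentiableAt ℝ (deriv f) x)
    (h0 : f x ≠ 0) :
    deriv (fun s => deriv f s / f s) x = deriv (deriv f) x / f x - (deriv f x / f x) ^ 2 := by
  rw [deriv_fun_div hf' hf h0]
  field_simp

theorem deriv_mul_deriv_self_div_sq (hf : DifferentiableAt ℝ f x)
    (hf' : DifferentiableAt ℝ (deriv f) x) (hg : DifferentiableAt ℝ g x) (h0 : g x ≠ 0) :
    deriv (fun s => f s * deriv f s / g s ^ 2) x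
      = (deriv f x ^ 2 + f x * deriv (deriv f) x) / g x ^ 2
        - 2 * f x * deriv f x * deriv g x / g x ^ 3 := by
  have h := deriv_fun_div (c := fun s => f s * deriv f s) (d := fun s => g s ^ 2) (hf.mul hf')
    (hg.pow 2) (pow_ne_zero 2 h0)
  rw [h, deriv_mul_deriv_self hf hf', deriv_sq hg]
  field_simp

end Derivatives

/-! ### Riemann and Ricci components of the warped metric -/

section Curvature

variable {N : ℕ} {T I : Set ℝ} {U : Set (Fin N → ℝ)}
  {ψ : (Fin N → ℝ) → EuclideanSpace ℝ (Fin (N + 1))} {b a f₁ f₂ : ℝ → ℝ}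

/-- The standing assumptions on the spherical doubly warped metric. -/
structure IsSphericalData (T I : Set ℝ) (U : Set (Fin N → ℝ))
    (ψ : (Fin N → ℝ) → EuclideanSpace ℝ (Fin (N + 1))) (b a f₁ f₂ : ℝ → ℝ) : Prop where
  isOpen_T : IsOpen T
  isOpen_I : IsOpen I
  param : IsSphereParam U ψ
  b_smooth : ContDiffOn ℝ 2 b I
  a_smooth : ContDiffOn ℝ 2 a T
  f₁_smooth : ContDiffOn ℝ 2 f₁ I
  f₂_smooth : ContDiffOn ℝ 2 f₂ I
  b_ne_zero : ∀ r ∈ I, b r ≠ 0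
  a_ne_zero : ∀ t ∈ T, a t ≠ 0
  f₁_ne_zero : ∀ r ∈ I, f₁ r ≠ 0
  f₂_ne_zero : ∀ r ∈ I, f₂ r ≠ 0

variable (H : IsSphericalData T I U ψ b a f₁ f₂) {t r : ℝ} {θ : Fin N → ℝ}
  (ht : t ∈ T) (hr : r ∈ I) (hθ : θ ∈ U)

include H ht hr hθ

theorem IsSphericalData.christoffel_eq (k i j : Option (Option (Fin N))) :
    christoffel (sphericalMetric b a f₁ f₂ ψ) k i j (extend t (extend r θ))
      = sphericalChristoffel b a f₁ f₂ ψ k i j t r θ :=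
  christoffel_sphericalMetric (differentiableAt_of_contDiffOn_two H.isOpen_I H.b_smooth hr)
    (differentiableAt_of_contDiffOn_two H.isOpen_T H.a_smooth ht)
    (differentiableAt_of_contDiffOn_two H.isOpen_I H.f₁_smooth hr)
    (differentiableAt_of_contDiffOn_two H.isOpen_I H.f₂_smooth hr)
    (H.b_ne_zero r hr) (H.a_ne_zero t ht) (H.f₁_ne_zero r hr) (H.f₂_ne_zero r hr)
    (isUnit_det_roundMetric H.param hθ) k i j

/-- The closed form of the Christoffel symbols holds at all nearby points, so it may replace them
under the derivative; the same applies to r and to the angles. -/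
theorem IsSphericalData.partialDeriv_t (k i j : Option (Option (Fin N))) :
    partialDeriv none (christoffel (sphericalMetric b a f₁ f₂ ψ) k i j) (extend t (extend r θ))
      = deriv (fun s => sphericalChristoffel b a f₁ f₂ ψ k i j s r θ) t := by
  rw [partialDeriv_none_extend]
  apply EventuallyEq.deriv_eq
  filter_upwards [H.isOpen_T.mem_nhds ht] with s hs using H.christoffel_eq hs hr hθ k i j

theorem IsSphericalData.partialDeriv_r (k i j : Option (Option (Fin N))) :
    partialDeriv (some none) (christoffel (sphericalMetric b a f₁ f₂ ψ) k i j)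
        (extend t (extend r θ))
      = deriv (fun s => sphericalChristoffel b a f₁ f₂ ψ k i j t s θ) r := by
  rw [partialDeriv_some_extend, partialDeriv_none_extend]
  apply EventuallyEq.deriv_eq
  filter_upwards [H.isOpen_I.mem_nhds hr] with s hs using H.christoffel_eq ht hs hθ k i j

theorem IsSphericalData.partialDeriv_s (k i j : Option (Option (Fin N))) (c : Fin N) :
    partialDeriv (some (some c)) (christoffel (sphericalMetric b a f₁ f₂ ψ) k i j)
        (extend t (extend r θ))
      = partialDeriv c (fun z => sphericalChristoffel b a f₁ f₂ ψ k i j t r z) θ := by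
  rw [partialDeriv_some_extend, partialDeriv_some_extend]
  exact partialDeriv_congr H.param.isOpen (fun z hz => H.christoffel_eq ht hr hz k i j) hθ c

theorem IsSphericalData.riemannUp_t_r_r_t :
    riemannUp (sphericalMetric b a f₁ f₂ ψ) none (some none) (some none) none
        (extend t (extend r θ))
      = -(a t * deriv (deriv a) t * f₁ r ^ 2 / b r ^ 2) + deriv (deriv b) r / b r
        - deriv f₁ r * deriv b r / (f₁ r * b r) := by
  have hb := differentiableAt_of_contDiffOn_two H.isOpen_I H.b_smooth hr
  have ha := differentiableAt_of_contDiffOn_two H.isOpen_T H.a_smooth ht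
  have hb' := differentiableAt_deriv_of_contDiffOn_two H.isOpen_I H.b_smooth hr
  have ha' := differentiableAt_deriv_of_contDiffOn_two H.isOpen_T H.a_smooth ht
  have hb0 := H.b_ne_zero r hr
  have ha0 := H.a_ne_zero t ht
  have hf₁0 := H.f₁_ne_zero r hr
  simp only [riemannUp, H.partialDeriv_t ht hr hθ, H.partialDeriv_r ht hr hθ,
    H.christoffel_eq ht hr hθ, Fintype.sum_option,
    sphericalChristoffel, deriv_mul_const_field, deriv_mul_deriv_self ha ha',
    deriv_logDeriv hb hb' hb0, mul_zero, sub_self, Finset.sum_const_zero]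
  field_simp
  ring

theorem IsSphericalData.riemannUp_t_s_s_t (c d : Fin N) :
    riemannUp (sphericalMetric b a f₁ f₂ ψ) none (some (some c)) (some (some d)) none
        (extend t (extend r θ))
      = (-(a t * deriv (deriv a) t * f₂ r ^ 2 / b r ^ 2)
        + f₂ r * deriv f₂ r * deriv b r / (f₁ r ^ 2 * b r)) * roundMetric ψ θ c d := by
  have ha := differentiableAt_of_contDiffOn_two H.isOpen_T H.a_smooth ht
  have ha' := differentiableAt_deriv_of_contDiffOn_two H.isOpen_T H.a_smooth ht
  have hb0 := H.b_ne_zero r hr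
  have ha0 := H.a_ne_zero t ht
  have hf₁0 := H.f₁_ne_zero r hr
  simp only [riemannUp, H.partialDeriv_t ht hr hθ,
    H.partialDeriv_s ht hr hθ, H.christoffel_eq ht hr hθ, Fintype.sum_option,
    sphericalChristoffel, deriv_mul_const_field, deriv_mul_deriv_self ha ha', partialDeriv_const,
    mul_zero, zero_mul, sub_self, ite_mul, sub_zero, Finset.sum_ite_eq',
    Finset.mem_univ, if_true]
  field_simp
  ring

theorem IsSphericalData.riemannUp_t_r_s_t (d : Fin N) :
    riemannUp (sphericalMetric b a f₁ f₂ ψ) none (some none) (some (some d)) none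
        (extend t (extend r θ)) = 0 := by
  simp only [riemannUp, H.partialDeriv_t ht hr hθ, H.partialDeriv_r ht hr hθ,
    H.christoffel_eq ht hr hθ, Fintype.sum_option,
    sphericalChristoffel]
  simp

theorem IsSphericalData.riemannUp_t_s_r_t (d : Fin N) :
    riemannUp (sphericalMetric b a f₁ f₂ ψ) none (some (some d)) (some none) none
        (extend t (extend r θ)) = 0 := by
  simp only [riemannUp, H.partialDeriv_t ht hr hθ,
    H.partialDeriv_s ht hr hθ, H.christoffel_eq ht hr hθ, Fintype.sum_option,
    sphericalChristoffel, partialDeriv_const]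
  simp

theorem IsSphericalData.riemannUp_t_x_t_t (μ : Option (Fin N)) :
    riemannUp (sphericalMetric b a f₁ f₂ ψ) none (some μ) none none
        (extend t (extend r θ)) = 0 := by
  have hb0 := H.b_ne_zero r hr
  have ha0 := H.a_ne_zero t ht
  have hf₁0 := H.f₁_ne_zero r hr
  cases μ <;> simp only [riemannUp, H.partialDeriv_t ht hr hθ, H.partialDeriv_r ht hr hθ,
    H.partialDeriv_s ht hr hθ, H.christoffel_eq ht hr hθ, Fintype.sum_option,
    sphericalChristoffel, partialDeriv_const, deriv_const, mul_zero, zero_mul, sub_self,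
    Finset.sum_const_zero, add_zero, zero_add, neg_zero]
  field_simp
  simp

/-- The N angular directions contribute equally to the trace through Kronecker deltas, which
produces the factors N. -/
theorem IsSphericalData.ricci_tt :
    ricci (sphericalMetric b a f₁ f₂ ψ) none none (extend t (extend r θ))
      = -((N : ℝ) + 1) * (deriv (deriv a) t / a t)
        + b r / (a t ^ 2 * f₁ r ^ 2) * (deriv (deriv b) r - deriv b r * deriv f₁ r / f₁ r
          + N * deriv b r * deriv f₂ r / f₂ r) := by
  have hb := differentiableAt_of_contDiffOn_two H.isOpen_I H.b_smooth hr
  have ha := differentiableAt_of_contDiffOn_two H.isOpen_T H.a_smooth ht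
  have hf₁ := differentiableAt_of_contDiffOn_two H.isOpen_I H.f₁_smooth hr
  have hb' := differentiableAt_deriv_of_contDiffOn_two H.isOpen_I H.b_smooth hr
  have ha' := differentiableAt_deriv_of_contDiffOn_two H.isOpen_T H.a_smooth ht
  have hb0 := H.b_ne_zero r hr
  have ha0 := H.a_ne_zero t ht
  have hf₁0 := H.f₁_ne_zero r hr
  have hf₂0 := H.f₂_ne_zero r hr
  simp only [ricci, riemannUp, H.partialDeriv_t ht hr hθ, H.partialDeriv_r ht hr hθ,
    H.partialDeriv_s ht hr hθ, H.christoffel_eq ht hr hθ, Fintype.sum_option,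
    sphericalChristoffel, deriv_const_mul_field, partialDeriv_const,
    deriv_logDeriv ha ha' ha0, deriv_mul_deriv_self_div_sq hb hb' hf₁ hf₁0, deriv_const,
    mul_zero, zero_mul, sub_self, Finset.sum_const_zero, ite_mul, mul_ite, sub_zero, zero_sub,
    Finset.sum_ite_eq, add_zero, zero_add, neg_zero, Finset.sum_neg_distrib,
    Finset.mem_univ, if_true, Finset.sum_const, Finset.card_univ, Fintype.card_fin, nsmul_eq_mul]
  field_simp
  ring

theorem IsSphericalData.ricci_rr :
    ricci (sphericalMetric b a f₁ f₂ ψ) (some none) (some none) (extend t (extend r θ))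
      = a t ^ 2 * f₁ r ^ 2 / b r ^ 2 * (deriv (deriv a) t / a t + N * (deriv a t / a t) ^ 2)
        - (deriv (deriv b) r / b r - deriv b r * deriv f₁ r / (b r * f₁ r))
        - N * (deriv (deriv f₂) r / f₂ r - deriv f₁ r * deriv f₂ r / (f₁ r * f₂ r)) := by
  have hb := differentiableAt_of_contDiffOn_two H.isOpen_I H.b_smooth hr
  have ha := differentiableAt_of_contDiffOn_two H.isOpen_T H.a_smooth ht
  have hf₂ := differentiableAt_of_contDiffOn_two H.isOpen_I H.f₂_smooth hr
  have hb' := differentiableAt_deriv_of_contDiffOn_two H.isOpen_I H.b_smooth hr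
  have ha' := differentiableAt_deriv_of_contDiffOn_two H.isOpen_T H.a_smooth ht
  have hf₂' := differentiableAt_deriv_of_contDiffOn_two H.isOpen_I H.f₂_smooth hr
  have hb0 := H.b_ne_zero r hr
  have ha0 := H.a_ne_zero t ht
  have hf₁0 := H.f₁_ne_zero r hr
  have hf₂0 := H.f₂_ne_zero r hr
  simp only [ricci, riemannUp, H.partialDeriv_t ht hr hθ, H.partialDeriv_r ht hr hθ,
    H.partialDeriv_s ht hr hθ, H.christoffel_eq ht hr hθ, Fintype.sum_option,
    sphericalChristoffel, deriv_mul_const_field, partialDeriv_const,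
    deriv_mul_deriv_self ha ha', deriv_logDeriv hb hb' hb0, deriv_logDeriv hf₂ hf₂' hf₂0,
    if_true, mul_zero, zero_mul, sub_self, Finset.sum_const_zero, ite_mul, mul_ite, sub_zero, zero_sub,
    Finset.sum_ite_eq, add_zero, neg_zero, Finset.sum_neg_distrib,
    Finset.mem_univ, Finset.sum_const, Finset.card_univ, Fintype.card_fin, nsmul_eq_mul]
  field_simp
  ring

/-- The two surviving terms are both f₂'/f₂ times the trace Γ^d_{dc} of the sphere connection, with
opposite signs. -/
theorem IsSphericalData.ricci_rs (c : Fin N) :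
    ricci (sphericalMetric b a f₁ f₂ ψ) (some none) (some (some c)) (extend t (extend r θ))
      = 0 := by
  simp only [ricci, riemannUp, H.partialDeriv_t ht hr hθ, H.partialDeriv_r ht hr hθ,
    H.partialDeriv_s ht hr hθ, H.christoffel_eq ht hr hθ, Fintype.sum_option,
    sphericalChristoffel, deriv_const, partialDeriv_const, ite_mul, mul_ite,
    mul_zero, zero_mul]
  simp [mul_comm]

theorem IsSphericalData.ricci_sr (c : Fin N) :
    ricci (sphericalMetric b a f₁ f₂ ψ) (some (some c)) (some none) (extend t (extend r θ))
      = 0 := by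
  simp only [ricci, riemannUp, H.partialDeriv_t ht hr hθ, H.partialDeriv_r ht hr hθ,
    H.partialDeriv_s ht hr hθ, H.christoffel_eq ht hr hθ, Fintype.sum_option,
    sphericalChristoffel, deriv_const, partialDeriv_const, ite_mul, mul_ite,
    mul_zero, zero_mul, if_true]
  simp [christoffel_roundMetric_symm ψ _ c, mul_comm]

theorem IsSphericalData.ricci_ss (c d : Fin N) :
    ricci (sphericalMetric b a f₁ f₂ ψ) (some (some c)) (some (some d)) (extend t (extend r θ))
      = (a t ^ 2 * f₂ r ^ 2 / b r ^ 2 * (deriv (deriv a) t / a t + N * (deriv a t / a t) ^ 2)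
        - f₂ r * deriv f₂ r * deriv b r / (f₁ r ^ 2 * b r) + (N - 1)
        - f₂ r * deriv (deriv f₂) r / f₁ r ^ 2 + f₂ r * deriv f₂ r * deriv f₁ r / f₁ r ^ 3
        - (N - 1) * deriv f₂ r ^ 2 / f₁ r ^ 2) * roundMetric ψ θ c d := by
  have ha := differentiableAt_of_contDiffOn_two H.isOpen_T H.a_smooth ht
  have hf₁ := differentiableAt_of_contDiffOn_two H.isOpen_I H.f₁_smooth hr
  have hf₂ := differentiableAt_of_contDiffOn_two H.isOpen_I H.f₂_smooth hr
  have ha' := differentiableAt_deriv_of_contDiffOn_two H.isOpen_T H.a_smooth ht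
  have hf₂' := differentiableAt_deriv_of_contDiffOn_two H.isOpen_I H.f₂_smooth hr
  have hb0 := H.b_ne_zero r hr
  have ha0 := H.a_ne_zero t ht
  have hf₁0 := H.f₁_ne_zero r hr
  have hf₂0 := H.f₂_ne_zero r hr
  have hR := ricci_roundMetric H.param hθ c d
  simp only [ricci, riemannUp, Finset.sum_add_distrib, Finset.sum_sub_distrib,
    Finset.sum_neg_distrib] at hR
  simp only [ricci, riemannUp, H.partialDeriv_t ht hr hθ, H.partialDeriv_r ht hr hθ,
    H.partialDeriv_s ht hr hθ, H.christoffel_eq ht hr hθ, Fintype.sum_option,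
    sphericalChristoffel, deriv_mul_const_field, partialDeriv_const,
    deriv_mul_deriv_self ha ha', deriv_mul_deriv_self_div_sq hf₂ hf₂' hf₁ hf₁0,
    deriv.fun_neg, if_true, Finset.sum_add_distrib, Finset.sum_sub_distrib,
    mul_zero, zero_mul, Finset.sum_const_zero, ite_mul, mul_ite,
    Finset.sum_ite_eq', zero_add, Finset.sum_neg_distrib,
    Finset.mem_univ, Finset.sum_const, Finset.card_univ, Fintype.card_fin, nsmul_eq_mul]
  -- One sphere term becomes a variable, so that the Ricci identity of the sphere can be solved for
  -- it and substituted; the other sphere terms then cancel, leaving (N - 1)γ.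
  generalize ∑ x, partialDeriv c (christoffel (roundMetric ψ) x x d) θ = A at hR ⊢
  rw [add_assoc, neg_add_eq_iff_eq_add, add_comm A] at hR
  obtain rfl := eq_sub_of_add_eq' hR.symm
  field_simp
  ring

end Curvature

/-! ### The electric tensor -/

section Electric

variable {N : ℕ} {T I : Set ℝ} {U : Set (Fin N → ℝ)}
  {ψ : (Fin N → ℝ) → EuclideanSpace ℝ (Fin (N + 1))} {b a f₁ f₂ : ℝ → ℝ}

theorem electric_sphericalMetric (t r : ℝ) (θ : Fin N → ℝ) (k l : Option (Option (Fin N))) :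
    electric (sphericalMetric b a f₁ f₂ ψ) (sphericalVelocity b) k l (extend t (extend r θ))
      = (1 / b r) ^ 2 * weyl (sphericalMetric b a f₁ f₂ ψ) none k l none
          (extend t (extend r θ)) := by
  have h0 : sphericalVelocity b (extend t (extend r θ)) none = 1 / b r := rfl
  have h1 : ∀ μ, sphericalVelocity b (extend t (extend r θ)) (some μ) = 0 := fun μ => rfl
  simp only [electric, Fintype.sum_option (α := Option (Fin N)), h0, h1, zero_mul, mul_zero,
    Finset.sum_const_zero, add_zero, sq]

theorem riemann_sphericalMetric_t (t r : ℝ) (θ : Fin N → ℝ) (k l : Option (Option (Fin N))) :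
    riemann (sphericalMetric b a f₁ f₂ ψ) none k l none (extend t (extend r θ))
      = -b r ^ 2 * riemannUp (sphericalMetric b a f₁ f₂ ψ) none k l none
          (extend t (extend r θ)) := by
  rw [riemann, Fintype.sum_option]
  simp only [sphericalMetric_st, sphericalMetric_tt, mul_zero, Finset.sum_const_zero, add_zero]
  ring

theorem riemannUp_self {ι : Type*} [Fintype ι] [DecidableEq ι] (g : (ι → ℝ) → Matrix ι ι ℝ)
    (j l m : ι) (x : ι → ℝ) : riemannUp g j j l m x = 0 := by
  simp [riemannUp]

/-- All parts of C_{ttlt} vanish by antisymmetry in the first index pair. -/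
theorem electric_t_left (t r : ℝ) (θ : Fin N → ℝ) (l : Option (Option (Fin N))) :
    electric (sphericalMetric b a f₁ f₂ ψ) (sphericalVelocity b) none l (extend t (extend r θ))
      = 0 := by
  rw [electric_sphericalMetric, weyl, riemann_sphericalMetric_t, riemannUp_self]
  ring

variable (H : IsSphericalData T I U ψ b a f₁ f₂) {t r : ℝ} {θ : Fin N → ℝ}
  (ht : t ∈ T) (hr : r ∈ I) (hθ : θ ∈ U)

include H ht hr hθ

/-- Antisymmetry in the last pair is not built into the definition, so R_{tμt}^t is computed
directly. The terms g_tt R_{μt} cancel each other, so R_{μt} is never needed. -/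
theorem IsSphericalData.electric_t_right (μ : Option (Fin N)) :
    electric (sphericalMetric b a f₁ f₂ ψ) (sphericalVelocity b) (some μ) none
      (extend t (extend r θ)) = 0 := by
  rw [electric_sphericalMetric, weyl, riemann_sphericalMetric_t, H.riemannUp_t_x_t_t ht hr hθ,
    sphericalMetric_st]
  ring

/-- The inverse metric is block diagonal, so mixed Ricci components drop out, and the sphere block
is traced with γ^{cd}γ_{cd} = N. -/
theorem IsSphericalData.scalarCurvature_eq :
    scalarCurvature (sphericalMetric b a f₁ f₂ ψ) (extend t (extend r θ))
      = 2 * (N + 1) / b r ^ 2 * (deriv (deriv a) t / a t)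
        + N * (N + 1) / b r ^ 2 * (deriv a t / a t) ^ 2
        + (-2 * (deriv (deriv b) r / b r - deriv b r * deriv f₁ r / (b r * f₁ r))
          - 2 * N * (deriv b r * deriv f₂ r / (b r * f₂ r))
          - 2 * N * (deriv (deriv f₂) r / f₂ r - deriv f₁ r * deriv f₂ r / (f₁ r * f₂ r))
          - N * (N - 1) * (deriv f₂ r / f₂ r) ^ 2 + N * (N - 1) * f₁ r ^ 2 / f₂ r ^ 2)
          / (a t ^ 2 * f₁ r ^ 2) := by
  have hb0 := H.b_ne_zero r hr
  have ha0 := H.a_ne_zero t ht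
  have hf₁0 := H.f₁_ne_zero r hr
  have hf₂0 := H.f₂_ne_zero r hr
  have htr : ∑ c, ∑ d, (roundMetric ψ θ)⁻¹ c d * roundMetric ψ θ c d = (N : ℝ) := by
    have h := Matrix.nonsing_inv_mul _ (isUnit_det_roundMetric H.param hθ)
    have h' : ∀ c, ∑ d, (roundMetric ψ θ)⁻¹ c d * roundMetric ψ θ c d = (1 : ℝ) := fun c => by
      simp_rw [roundMetric_symm ψ θ c]
      rw [← Matrix.mul_apply, h, Matrix.one_apply_eq]
    simp [h']
  have hs : ∀ x y : ℝ, ∑ c, ∑ d, x * (roundMetric ψ θ)⁻¹ c d * (y * roundMetric ψ θ c d)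
      = N * (x * y) := fun x y => by
    rw [← htr]
    simp only [Finset.sum_mul]
    exact Finset.sum_congr rfl fun c _ => Finset.sum_congr rfl fun d _ => by ring
  rw [scalarCurvature, inv_sphericalMetric b a f₁ f₂ ψ t r θ hb0 ha0 hf₁0 hf₂0
    (isUnit_det_roundMetric H.param hθ)]
  simp only [Fintype.sum_option, sphericalInverse, Matrix.of_apply, zero_mul,
    Finset.sum_const_zero, add_zero, zero_add, H.ricci_tt ht hr hθ, H.ricci_rr ht hr hθ,
    H.ricci_ss ht hr hθ, hs]
  field_simp
  ring

omit ht hθ in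
-- `Real.log` is log|·|, so the logarithmic derivatives are f'/f whatever the signs of f₁ and f₂.
theorem IsSphericalData.electricScalar_eq {n : ℕ} (hn : n = N + 2) :
    electricScalar n b f₁ f₂ r = ((N : ℝ) - 1) / N * (1 / f₁ r ^ 2) *
      (f₁ r ^ 2 / f₂ r ^ 2 + (deriv (deriv f₂) r / f₂ r - (deriv f₂ r / f₂ r) ^ 2)
        - deriv f₁ r * deriv f₂ r / (f₁ r * f₂ r)
        + deriv b r / b r * (deriv f₁ r / f₁ r + deriv f₂ r / f₂ r)
        - deriv (deriv b) r / b r) := by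
  have hf₁ := differentiableAt_of_contDiffOn_two H.isOpen_I H.f₁_smooth hr
  have hf₂ := differentiableAt_of_contDiffOn_two H.isOpen_I H.f₂_smooth hr
  have hf₂' := differentiableAt_deriv_of_contDiffOn_two H.isOpen_I H.f₂_smooth hr
  have hf₁0 := H.f₁_ne_zero r hr
  have hf₂0 := H.f₂_ne_zero r hr
  have h1 : deriv (deriv fun s => Real.log (f₂ s)) r
      = deriv (deriv f₂) r / f₂ r - (deriv f₂ r / f₂ r) ^ 2 := by
    rw [← deriv_logDeriv hf₂ hf₂' hf₂0]
    apply EventuallyEq.deriv_eq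
    filter_upwards [H.isOpen_I.mem_nhds hr] with s hs
    exact deriv.log (differentiableAt_of_contDiffOn_two H.isOpen_I H.f₂_smooth hs)
      (H.f₂_ne_zero s hs)
  have h2 : deriv (fun s => Real.log (f₁ s * f₂ s)) r
      = deriv f₁ r / f₁ r + deriv f₂ r / f₂ r := by
    have h := deriv.log (f := fun s => f₁ s * f₂ s) (hf₁.mul hf₂) (mul_ne_zero hf₁0 hf₂0)
    rw [h, deriv_fun_mul hf₁ hf₂]
    field_simp
  have h3 : (n : ℝ) = N + 2 := by rw [hn]; push_cast; ring
  rw [electricScalar, h1, h2, h3]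
  congr 3 <;> ring

/-- The space components of the electric tensor. -/
theorem IsSphericalData.electric_space {n : ℕ} (hn : n = N + 2) (hN : N ≠ 0)
    (μ ν : Option (Fin N)) :
    electric (sphericalMetric b a f₁ f₂ ψ) (sphericalVelocity b) (some μ) (some ν)
        (extend t (extend r θ))
      = electricScalar n b f₁ f₂ r *
        (radialCovector f₁ (extend r θ) μ * radialCovector f₁ (extend r θ) ν
          - spaceMetric f₁ f₂ ψ (extend r θ) μ ν / ((n : ℝ) - 1)) := by
  have hb0 := H.b_ne_zero r hr
  have ha0 := H.a_ne_zero t ht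
  have hf₁0 := H.f₁_ne_zero r hr
  have hf₂0 := H.f₂_ne_zero r hr
  have hN0 : (N : ℝ) ≠ 0 := by exact_mod_cast hN
  have hN1 : (N : ℝ) + 1 ≠ 0 := by positivity
  have h3 : (n : ℝ) - 1 = N + 1 := by rw [hn]; push_cast; ring
  have hc1 : (Fintype.card (Option (Option (Fin N))) : ℝ) - 1 = N + 1 := by
    simp only [Fintype.card_option, Fintype.card_fin]; push_cast; ring
  have hc2 : (Fintype.card (Option (Option (Fin N))) : ℝ) - 2 = N := by
    simp only [Fintype.card_option, Fintype.card_fin]; push_cast; ring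
  have hnr : radialCovector f₁ (extend r θ) none = f₁ r := rfl
  have hns : ∀ c, radialCovector f₁ (extend r θ) (some c) = 0 := fun c => rfl
  have hgr : spaceMetric f₁ f₂ ψ (extend r θ) none none = f₁ r ^ 2 := rfl
  have hgs : ∀ c d, spaceMetric f₁ f₂ ψ (extend r θ) (some c) (some d)
      = f₂ r ^ 2 * roundMetric ψ θ c d := fun c d => rfl
  have hrs : ∀ c, spaceMetric f₁ f₂ ψ (extend r θ) none (some c) = 0 := fun c => rfl
  have hsr : ∀ c, spaceMetric f₁ f₂ ψ (extend r θ) (some c) none = 0 := fun c => rfl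
  rw [electric_sphericalMetric, weyl, riemann_sphericalMetric_t, hc1, hc2, h3,
    sphericalMetric_tt, sphericalMetric_st, sphericalMetric_ts, H.ricci_tt ht hr hθ,
    H.scalarCurvature_eq ht hr hθ, H.electricScalar_eq hr hn]
  -- In the two diagonal blocks the a'' terms cancel because 1 - (N+2)/N + 2/N = 0, and the a'²
  -- terms because -1 + 1 = 0.
  rcases μ with _ | c <;> rcases ν with _ | d
  · rw [H.riemannUp_t_r_r_t ht hr hθ, H.ricci_rr ht hr hθ, sphericalMetric_rr, hnr, hgr]
    field_simp
    ring
  · rw [H.riemannUp_t_r_s_t ht hr hθ, H.ricci_rs ht hr hθ, sphericalMetric_rs, hns, hrs]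
    ring
  · rw [H.riemannUp_t_s_r_t ht hr hθ, H.ricci_sr ht hr hθ, sphericalMetric_sr, hns, hsr]
    ring
  · rw [H.riemannUp_t_s_s_t ht hr hθ, H.ricci_ss ht hr hθ, sphericalMetric_ss, hns, hgs]
    field_simp
    ring

end Electric

end DoublyWarped

end

/-! ### Normalizations and the covariant form -/

theorem mainTheorem3 (n N : ℕ) (hn : 3 ≤ n) (hN : n = N + 2)
    (T I : Set ℝ) (hT : IsOpen T) (hI : IsOpen I)
    (U : Set (Fin N → ℝ)) (ψ : (Fin N → ℝ) → EuclideanSpace ℝ (Fin (N + 1)))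
    (hψ : IsSphereParam U ψ)
    (b a f₁ f₂ : ℝ → ℝ)
    (hb : ContDiffOn ℝ 2 b I) (ha : ContDiffOn ℝ 2 a T)
    (hf₁ : ContDiffOn ℝ 2 f₁ I) (hf₂ : ContDiffOn ℝ 2 f₂ I)
    (hb0 : ∀ r ∈ I, b r ≠ 0) (ha0 : ∀ t ∈ T, a t ≠ 0)
    (hf₁0 : ∀ r ∈ I, f₁ r ≠ 0) (hf₂0 : ∀ r ∈ I, f₂ r ≠ 0)
    (t : ℝ) (ht : t ∈ T) (r : ℝ) (hr : r ∈ I) (θ : Fin N → ℝ) (hθ : θ ∈ U) :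
    -- `u` is a unit time-like vector, `n_μ` and `N_i` are unit space-like covectors
    (∑ i, ∑ j, sphericalMetric b a f₁ f₂ ψ (extend t (extend r θ)) i j
        * sphericalVelocity b (extend t (extend r θ)) i
        * sphericalVelocity b (extend t (extend r θ)) j = -1) ∧
    (∑ μ, ∑ ν, (spaceMetric f₁ f₂ ψ (extend r θ))⁻¹ μ ν
        * radialCovector f₁ (extend r θ) μ * radialCovector f₁ (extend r θ) ν = 1) ∧
    (∑ i, ∑ j, (sphericalMetric b a f₁ f₂ ψ (extend t (extend r θ)))⁻¹ i j
        * radialCovectorST a f₁ (extend t (extend r θ)) i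
        * radialCovectorST a f₁ (extend t (extend r θ)) j = 1) ∧
    -- space components of the electric tensor
    (∀ μ ν : Option (Fin N),
      electric (sphericalMetric b a f₁ f₂ ψ) (sphericalVelocity b) (some μ) (some ν)
          (extend t (extend r θ))
        = electricScalar n b f₁ f₂ r *
          (radialCovector f₁ (extend r θ) μ * radialCovector f₁ (extend r θ) ν
            - spaceMetric f₁ f₂ ψ (extend r θ) μ ν / ((n : ℝ) - 1))) ∧
    -- covariant form on spacetime, with `h_{ij} = g_{ij} + u_i u_j`
    (∀ i j : Option (Option (Fin N)),
      electric (sphericalMetric b a f₁ f₂ ψ) (sphericalVelocity b) i j (extend t (extend r θ))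
        = electricScalar n b f₁ f₂ r / a t ^ 2 *
          (radialCovectorST a f₁ (extend t (extend r θ)) i
              * radialCovectorST a f₁ (extend t (extend r θ)) j
            - (sphericalMetric b a f₁ f₂ ψ (extend t (extend r θ)) i j
                + lower (sphericalMetric b a f₁ f₂ ψ) (sphericalVelocity b)
                    (extend t (extend r θ)) i
                  * lower (sphericalMetric b a f₁ f₂ ψ) (sphericalVelocity b)
                    (extend t (extend r θ)) j) / ((n : ℝ) - 1))) := by
  have H : IsSphericalData T I U ψ b a f₁ f₂ :=
    ⟨hT, hI, hψ, hb, ha, hf₁, hf₂, hb0, ha0, hf₁0, hf₂0⟩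
  have hb0' := hb0 r hr
  have ha0' := ha0 t ht
  have hf₁0' := hf₁0 r hr
  have hf₂0' := hf₂0 r hr
  have hγ := isUnit_det_roundMetric hψ hθ
  have hut : sphericalVelocity b (extend t (extend r θ)) none = 1 / b r := rfl
  have hus : ∀ μ, sphericalVelocity b (extend t (extend r θ)) (some μ) = 0 := fun μ => rfl
  have hnr : radialCovector f₁ (extend r θ) none = f₁ r := rfl
  have hns : ∀ c, radialCovector f₁ (extend r θ) (some c) = 0 := fun c => rfl
  have hNt : radialCovectorST a f₁ (extend t (extend r θ)) none = 0 := rfl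
  have hNs : ∀ μ, radialCovectorST a f₁ (extend t (extend r θ)) (some μ)
      = a t * radialCovector f₁ (extend r θ) μ := fun μ => rfl
  have hg : ∀ μ ν, sphericalMetric b a f₁ f₂ ψ (extend t (extend r θ)) (some μ) (some ν)
      = a t ^ 2 * spaceMetric f₁ f₂ ψ (extend r θ) μ ν := fun μ ν => rfl
  have hlt : lower (sphericalMetric b a f₁ f₂ ψ) (sphericalVelocity b) (extend t (extend r θ)) none
      = -b r := by
    rw [lower, Fintype.sum_option]
    simp only [sphericalMetric_tt, hut, hus, mul_zero, Finset.sum_const_zero, add_zero]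
    field_simp
  have hls : ∀ μ, lower (sphericalMetric b a f₁ f₂ ψ) (sphericalVelocity b)
      (extend t (extend r θ)) (some μ) = 0 := fun μ => by
    rw [lower, Fintype.sum_option]
    simp only [sphericalMetric_st, hus, mul_zero, zero_mul, Finset.sum_const_zero, add_zero]
  have hE := H.electric_space ht hr hθ hN (by omega)
  refine ⟨?_, ?_, ?_, hE, ?_⟩
  · simp only [Fintype.sum_option (α := Option (Fin N)), hut, hus, sphericalMetric_tt, mul_zero,
      zero_mul, Finset.sum_const_zero, add_zero]
    field_simp
  · simp only [Fintype.sum_option, hnr, hns, mul_zero, zero_mul, Finset.sum_const_zero, add_zero,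
      inv_spaceMetric_rr f₁ f₂ ψ r θ hf₁0' hf₂0' hγ]
    field_simp
  · rw [inv_sphericalMetric b a f₁ f₂ ψ t r θ hb0' ha0' hf₁0' hf₂0' hγ]
    simp only [Fintype.sum_option, hNt, hNs, hnr, hns, sphericalInverse, Matrix.of_apply, mul_zero,
      zero_mul, Finset.sum_const_zero, add_zero, zero_add]
    field_simp
  -- Since u_t = -b, g_tt + u_t² = 0, so the right side vanishes on time indices; on space indices
  -- its factor a² cancels the 1/a².
  · rintro (_ | μ) (_ | ν)
    · rw [electric_t_left, hNt, hlt, sphericalMetric_tt]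
      ring
    · rw [electric_t_left, hNt, hls, sphericalMetric_ts]
      ring
    · rw [H.electric_t_right ht hr hθ, hNt, hls, sphericalMetric_st]
      ring
    · rw [hE, hNs, hNs, hls, hls, hg]
      field_simp
      ring
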